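/- Fix countably many propositional letters. Let $\mathcal L$ be the language with connectives $\neg,\wedge$ and unary operators $L_r$ ($r\in\mathbb Q\cap[0,1]$), and let $\mathcal L_{HK}$ be $\mathcal L$ with one further unary operator $K$; a formula of $\mathcal L_{HK}$ is $K$-free if it belongs to $\mathcal L$. A logic in a language is a set of its formulas that contains all propositional tautologies and is closed under modus ponens and uniform substitution; $\vdash\phi$ means that $\phi$ belongs to it. $\Sigma_H$ is the smallest logic in $\mathcal L$ that contains, for all formulas and all indices in $\mathbb Q\cap[0,1]$, $L_0\phi$; $\;L_r\top$; $\;L_r(\phi\wedge\psi)\wedge L_t(\phi\wedge\neg\psi)\to L_{r+t}\phi$ and $\neg L_r(\phi\wedge\psi)\wedge\neg L_t(\phi\wedge\neg\psi)\to\neg L_{r+t}\phi$ for $r+t\le 1$; $\;L_r\phi\to\neg L_s\neg\phi$ for $r+s>1$; $\;L_r\phi\to L_1L_r\phi$; $\;\neg L_r\phi\to L_1\neg L_r\phi$; and is closed under the rules: if $\vdash\phi\leftrightarrow\psi$ then $\vdash L_r\phi\leftrightarrow L_r\psi$; and, if $\vdash\gamma\to L_s\phi$ for all $s<r$, then $\vdash\gamma\to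 L_r\phi$. $\Sigma_{HK}$ is the smallest logic in $\mathcal L_{HK}$ that contains the above axioms and is closed under the above rules for all formulas of $\mathcal L_{HK}$, contains the S5 axioms $K(\phi\to\psi)\to(K\phi\to K\psi)$, $K\phi\to\phi$, $K\phi\to KK\phi$, $\neg K\phi\to K\neg K\phi$, is closed under generalization (if $\vdash\phi$ then $\vdash K\phi$), and contains the axioms $L_r\phi\to KL_r\phi$, $\neg L_r\phi\to K\neg L_r\phi$, $K\phi\to L_1\phi$. A Harsanyi type space $\langle\Omega,\mathcal A,T\rangle$ is a nonempty measurable space $(\Omega,\mathcal A)$ with a measurable map $T$ from $\Omega$ to the probability measures on $(\Omega,\mathcal A)$ (a Markov kernel) such that, writing $[T(w)]=\{w'\in\Omega: T(w')=T(w)\}$, one has $T(w)(E)=1$ whenever $w\in\Omega$ and $[T(w)]\subseteq E\in\mathcal A$. A knowledge-belief space $\langle\Omega,\mathcal A,T,\Pi\rangle$ is a Harsanyi type space with a partition $\Pi$ of $\Omega$, with $\Pi(w)$ the cell of $w$, such that for all $w\in\Omega$ and $E\in\mathcal A$: $\Pi(w)\subseteq E$ implies $T(w)(E)=1$, and $[T(w)]\subseteq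 E$ implies $\Pi(w)\subseteq E$. Then: 1. For every Harsanyi type space $\langle\Omega,\mathcal A,T\rangle$, setting $\Pi(w)=[T(w)]$ makes $\langle\Omega,\mathcal A,T,\Pi\rangle$ a knowledge-belief space. 2. $\Sigma_{HK}$ is a conservative extension of $\Sigma_H$: for every $K$-free formula $\phi$, $\phi\in\Sigma_{HK}$ if and only if $\phi\in\Sigma_H$. -/

import Mathlib

open MeasureTheory ProbabilityTheory

/-- Formulas over countably many propositional letters, with connectives `¬`, `∧` and a family
of unary operators indexed by `O`. -/
inductive Formula (O : Type) : Type where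
  | letter : ℕ → Formula O
  | neg : Formula O → Formula O
  | and : Formula O → Formula O → Formula O
  | op : O → Formula O → Formula O

namespace Formula

variable {O : Type}

def imp (φ ψ : Formula O) : Formula O := neg (and φ (neg ψ))

def iff (φ ψ : Formula O) : Formula O := and (imp φ ψ) (imp ψ φ)

/-- Verum, as the tautology `¬(p ∧ ¬p)` for the first propositional letter `p`. -/
def top : Formula O := neg (and (letter 0) (neg (letter 0)))

/-- Uniform substitution of formulas for the propositional letters. -/
def subst (σ : ℕ → Formula O) : Formula O → Formula O
  | letter n => σ n
  | neg φ => neg (subst σ φ)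
  | and φ ψ => and (subst σ φ) (subst σ ψ)
  | op o φ => op o (subst σ φ)

/-- Renaming the operators; for an injective map this is the inclusion of a language in a larger
one. -/
def mapOp {O' : Type} (f : O → O') : Formula O → Formula O'
  | letter n => letter n
  | neg φ => neg (mapOp f φ)
  | and φ ψ => and (mapOp f φ) (mapOp f ψ)
  | op o φ => op (f o) (mapOp f φ)

/-- Propositional tautologies: true under every truth assignment that respects `¬` and `∧`
(letters and formulas that begin with an operator receive arbitrary truth values). -/
def IsTautology (φ : Formula O) : Prop :=
  ∀ v : Formula O → Prop,
    (∀ ψ, v (neg ψ) ↔ ¬ v ψ) → (∀ ψ χ, v (and ψ χ) ↔ (v ψ ∧ v χ)) → v φ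

end Formula

/-- A logic: a set of formulas that contains all propositional tautologies and is closed under
modus ponens and uniform substitution. -/
structure IsLogic {O : Type} (S : Set (Formula O)) : Prop where
  taut : ∀ φ : Formula O, φ.IsTautology → φ ∈ S
  mp : ∀ φ ψ : Formula O, φ.imp ψ ∈ S → φ ∈ S → ψ ∈ S
  subst : ∀ (σ : ℕ → Formula O) (φ : Formula O), φ ∈ S → φ.subst σ ∈ S

/-- Probability indices: the rationals in `[0, 1]`. -/
abbrev ProbIndex : Type := Set.Icc (0 : ℚ) 1

open Formula in
/-- The operators `L r` ("the probability is at least `r`") satisfy, in the set `S` of formulas,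
the axioms and rules of the basic probability logic. -/
structure SatisfiesProbabilityAxioms {O : Type} (L : ProbIndex → O) (S : Set (Formula O)) :
    Prop where
  zero : ∀ φ, op (L 0) φ ∈ S
  verum : ∀ r, op (L r) top ∈ S
  add : ∀ (r t u : ProbIndex) (φ ψ : Formula O), (u : ℚ) = (r : ℚ) + (t : ℚ) →
    imp (and (op (L r) (and φ ψ)) (op (L t) (and φ (neg ψ)))) (op (L u) φ) ∈ S
  neg_add : ∀ (r t u : ProbIndex) (φ ψ : Formula O), (u : ℚ) = (r : ℚ) + (t : ℚ) →
    imp (and (neg (op (L r) (and φ ψ))) (neg (op (L t) (and φ (neg ψ)))))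
      (neg (op (L u) φ)) ∈ S
  compl : ∀ (r s : ProbIndex) (φ : Formula O), 1 < (r : ℚ) + (s : ℚ) →
    imp (op (L r) φ) (neg (op (L s) (neg φ))) ∈ S
  dis : ∀ (r : ProbIndex) (φ ψ : Formula O), Formula.iff φ ψ ∈ S →
    Formula.iff (op (L r) φ) (op (L r) ψ) ∈ S
  arch : ∀ (r : ProbIndex) (γ φ : Formula O), (∀ s : ProbIndex, s < r → imp γ (op (L s) φ) ∈ S) →
    imp γ (op (L r) φ) ∈ S

open Formula in
/-- The introspection axioms for probabilistic belief. -/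
structure SatisfiesIntrospection {O : Type} (L : ProbIndex → O) (S : Set (Formula O)) :
    Prop where
  pos : ∀ (r : ProbIndex) (φ : Formula O),
    imp (op (L r) φ) (op (L 1) (op (L r) φ)) ∈ S
  neg : ∀ (r : ProbIndex) (φ : Formula O),
    imp (neg (op (L r) φ)) (op (L 1) (neg (op (L r) φ))) ∈ S

open Formula in
/-- The operator `K` satisfies, in the set `S` of formulas, the axioms and the rule of S5. -/
structure SatisfiesS5 {O : Type} (K : O) (S : Set (Formula O)) : Prop where
  normal : ∀ φ ψ : Formula O, imp (op K (imp φ ψ)) (imp (op K φ) (op K ψ)) ∈ S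
  gen : ∀ φ : Formula O, φ ∈ S → op K φ ∈ S
  refl : ∀ φ : Formula O, imp (op K φ) φ ∈ S
  pos : ∀ φ : Formula O, imp (op K φ) (op K (op K φ)) ∈ S
  neg : ∀ φ : Formula O, imp (neg (op K φ)) (op K (neg (op K φ))) ∈ S

open Formula in
/-- The axioms that connect knowledge and probabilistic belief. -/
structure SatisfiesKnowledgeBelief {O : Type} (L : ProbIndex → O) (K : O)
    (S : Set (Formula O)) : Prop where
  know_pos : ∀ (r : ProbIndex) (φ : Formula O), imp (op (L r) φ) (op K (op (L r) φ)) ∈ S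
  know_neg : ∀ (r : ProbIndex) (φ : Formula O),
    imp (neg (op (L r) φ)) (op K (neg (op (L r) φ))) ∈ S
  know_certain : ∀ φ : Formula O, imp (op K φ) (op (L 1) φ) ∈ S

/-- The language of probabilistic belief: the only operators are the `L r`. -/
abbrev BeliefFormula : Type := Formula ProbIndex

/-- The operators of the language of knowledge and probabilistic belief. -/
inductive KBOp : Type where
  | L : ProbIndex → KBOp
  | K : KBOp

/-- The language of knowledge and probabilistic belief. -/
abbrev KBFormula : Type := Formula KBOp

/-- Inclusion of the language of probabilistic belief; its range is the set of all `K`-free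
formulas. -/
def BeliefFormula.toKB (φ : BeliefFormula) : KBFormula := Formula.mapOp KBOp.L φ

/-- `Σ_H`: the smallest logic in the language of probabilistic belief with the axioms and rules of
basic probability logic and the introspection axioms. -/
def SigmaH : Set BeliefFormula :=
  ⋂₀ {S | IsLogic S ∧ SatisfiesProbabilityAxioms (fun r : ProbIndex => r) S ∧
    SatisfiesIntrospection (fun r : ProbIndex => r) S}

/-- `Σ_HK`: the smallest logic in the language of knowledge and probabilistic belief in which the
`L r` satisfy the axioms and rules of `Σ_H`, `K` satisfies those of S5, and the connecting axioms
hold. -/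
def SigmaHK : Set KBFormula :=
  ⋂₀ {S | IsLogic S ∧ SatisfiesProbabilityAxioms KBOp.L S ∧ SatisfiesIntrospection KBOp.L S ∧
    SatisfiesS5 KBOp.K S ∧ SatisfiesKnowledgeBelief KBOp.L KBOp.K S}

/-- A Harsanyi type space on the measurable space `Ω`: a type function `T` (a measurable map from
`Ω` to the probability measures on `Ω`, that is, a Markov kernel) such that every type is certain
of its type. -/
structure HarsanyiTypeSpace (Ω : Type*) [MeasurableSpace Ω] where
  T : Kernel Ω Ω
  isMarkovKernel : IsMarkovKernel T
  certain : ∀ (w : Ω) (E : Set Ω), MeasurableSet E → {w' | T w = T w'} ⊆ E → T w E = 1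

/-- The set `[T(w)]` of states with the same type as `w`. -/
def HarsanyiTypeSpace.typeClass {Ω : Type*} [MeasurableSpace Ω] (H : HarsanyiTypeSpace Ω)
    (w : Ω) : Set Ω := {w' | H.T w = H.T w'}

/-- A knowledge-belief space: a Harsanyi type space with a partition of `Ω`, given as an
equivalence relation. -/
structure KnowledgeBeliefSpace (Ω : Type*) [MeasurableSpace Ω] extends HarsanyiTypeSpace Ω where
  partition : Setoid Ω
  know_certain : ∀ (w : Ω) (E : Set Ω), MeasurableSet E →
    {w' | partition w w'} ⊆ E → T w E = 1
  know_type : ∀ (w : Ω) (E : Set Ω), MeasurableSet E →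
    {w' | T w = T w'} ⊆ E → {w' | partition w w'} ⊆ E

/-- The cell `Π(w)` of the partition. -/
def KnowledgeBeliefSpace.cell {Ω : Type*} [MeasurableSpace Ω] (M : KnowledgeBeliefSpace Ω)
    (w : Ω) : Set Ω := {w' | M.partition w w'}

/-! With cells `[T(w)]`, both conditions on a knowledge-belief space are immediate, and Σ_H ⊆ Σ_HK
is clear. For the converse, a formula outside Σ_H is omitted by a maximal consistent set `Γ` closed
under the Archimedean rule (`exists_isArchimedeanTheory`). From `Γ` comes a syntactic model: states
are truth assignments, all share the belief that `Γ` assigns to operator-free formulas, and `K` is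
truth at every state. All axioms and rules of Σ_HK are sound there (`sigmaHK_subset_validities`). By
introspection `Γ` is certain of every `L r φ` or of its negation, so replacing these by truth values
changes neither membership in `Γ` nor degrees of belief (`reduct_toKB`). If a `K`-free formula is in
Σ_HK, its reduct is a tautology, hence in `Γ`, and so is the formula itself. -/

namespace Formula

/-! ### Syntax, countability and valuations -/

variable {O O' : Type}

theorem mapOp_subst (f : O → O') (σ : ℕ → Formula O) (φ : Formula O) :
    (φ.subst σ).mapOp f = (φ.mapOp f).subst (fun n => (σ n).mapOp f) := by
  induction φ with
  | letter n => rfl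
  | neg φ ih => simp [subst, mapOp, ih]
  | and φ ψ ih₁ ih₂ => simp [subst, mapOp, ih₁, ih₂]
  | op o φ ih => simp [subst, mapOp, ih]

theorem subst_subst (σ τ : ℕ → Formula O) (φ : Formula O) :
    (φ.subst σ).subst τ = φ.subst (fun n => (σ n).subst τ) := by
  induction φ with
  | letter n => rfl
  | neg φ ih => simp [subst, ih]
  | and φ ψ ih₁ ih₂ => simp [subst, ih₁, ih₂]
  | op o φ ih => simp [subst, ih]

theorem subst_letter (φ : Formula O) : φ.subst letter = φ := by
  induction φ with
  | letter n => rfl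
  | neg φ ih => simp [subst, ih]
  | and φ ψ ih₁ ih₂ => simp [subst, ih₁, ih₂]
  | op o φ ih => simp [subst, ih]

theorem IsTautology.mapOp {φ : Formula O} (h : φ.IsTautology) (f : O → O') :
    (φ.mapOp f).IsTautology := fun v hn ha =>
  h (fun ψ => v (ψ.mapOp f)) (fun _ => hn _) (fun _ _ => ha _ _)

theorem IsTautology.subst {φ : Formula O} (h : φ.IsTautology) (σ : ℕ → Formula O) :
    (φ.subst σ).IsTautology := fun v hn ha =>
  h (fun ψ => v (ψ.subst σ)) (fun _ => hn _) (fun _ _ => ha _ _)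

/-- A Gödel numbering of the formulas, given one of the operators. -/
def code (e : O → ℕ) : Formula O → ℕ
  | letter n => Nat.pair 0 n
  | neg φ => Nat.pair 1 (code e φ)
  | and φ ψ => Nat.pair 2 (Nat.pair (code e φ) (code e ψ))
  | op o φ => Nat.pair 3 (Nat.pair (e o) (code e φ))

theorem code_injective {e : O → ℕ} (he : Function.Injective e) :
    Function.Injective (code e) := by
  intro φ
  induction φ with
  | letter n => intro ψ h; cases ψ <;> simp_all [code, Nat.pair_eq_pair]
  | neg φ ih =>
    intro ψ h
    cases ψ <;> simp [code, Nat.pair_eq_pair] at h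
    rw [ih h]
  | and φ χ ih₁ ih₂ =>
    intro ψ h
    cases ψ <;> simp [code, Nat.pair_eq_pair] at h
    rw [ih₁ h.1, ih₂ h.2]
  | op o φ ih =>
    intro ψ h
    cases ψ <;> simp [code, Nat.pair_eq_pair] at h
    rw [he h.1, ih h.2]

theorem countable [Countable O] : Countable (Formula O) :=
  let ⟨_, he⟩ := exists_injective_nat O
  (code_injective he).countable

/-- A truth assignment that respects the connectives. -/
structure IsValuation (v : Formula O → Prop) : Prop where
  neg : ∀ ψ, v (neg ψ) ↔ ¬ v ψ
  and : ∀ ψ χ, v (and ψ χ) ↔ (v ψ ∧ v χ)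

namespace IsValuation

variable {v : Formula O → Prop}

theorem imp (h : IsValuation v) (φ ψ : Formula O) : v (φ.imp ψ) ↔ (v φ → v ψ) := by
  rw [Formula.imp, h.neg, h.and, h.neg]; tauto

theorem iff (h : IsValuation v) (φ ψ : Formula O) : v (φ.iff ψ) ↔ (v φ ↔ v ψ) := by
  rw [Formula.iff, h.and, h.imp, h.imp]; tauto

theorem top (h : IsValuation v) : v top := by
  rw [Formula.top, h.neg, h.and, h.neg]; tauto

end IsValuation

theorem isTautology_iff {φ : Formula O} :
    φ.IsTautology ↔ ∀ v : Formula O → Prop, IsValuation v → v φ :=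
  ⟨fun h v hv => h v hv.neg hv.and, fun h v hn ha => h v ⟨hn, ha⟩⟩

end Formula

open Formula

/-! ### Closure of Σ_H and the easy inclusion -/

theorem isLogic_sigmaH : IsLogic SigmaH where
  taut φ h _ hS := hS.1.taut φ h
  mp φ ψ h₁ h₂ _ hS := hS.1.mp φ ψ (h₁ _ hS) (h₂ _ hS)
  subst σ φ h _ hS := hS.1.subst σ φ (h _ hS)

theorem satisfiesProbabilityAxioms_sigmaH :
    SatisfiesProbabilityAxioms (fun r : ProbIndex => r) SigmaH where
  zero φ _ hS := hS.2.1.zero φ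
  verum r _ hS := hS.2.1.verum r
  add r t u φ ψ h _ hS := hS.2.1.add r t u φ ψ h
  neg_add r t u φ ψ h _ hS := hS.2.1.neg_add r t u φ ψ h
  compl r s φ h _ hS := hS.2.1.compl r s φ h
  dis r φ ψ h _ hS := hS.2.1.dis r φ ψ (h _ hS)
  arch r γ φ h _ hS := hS.2.1.arch r γ φ fun s hs => h s hs _ hS

theorem satisfiesIntrospection_sigmaH :
    SatisfiesIntrospection (fun r : ProbIndex => r) SigmaH where
  pos r φ _ hS := hS.2.2.pos r φ
  neg r φ _ hS := hS.2.2.neg r φ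

/-- The preimage under `toKB` of any set that competes in the definition of Σ_HK competes in that of
Σ_H. -/
theorem toKB_mem_sigmaHK {φ : BeliefFormula} (hφ : φ ∈ SigmaH) : φ.toKB ∈ SigmaHK := by
  rintro S ⟨hl, hp, hi, -, -⟩
  refine hφ {ψ | ψ.toKB ∈ S} ⟨⟨fun ψ h => hl.taut _ (h.mapOp _), fun ψ χ h₁ h₂ => hl.mp _ _ h₁ h₂,
    fun σ ψ h => ?_⟩, ⟨fun ψ => hp.zero _, hp.verum, fun r t u ψ χ h => hp.add r t u _ _ h,
    fun r t u ψ χ h => hp.neg_add r t u _ _ h, fun r s ψ h => hp.compl r s _ h,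
    fun r ψ χ h => hp.dis r _ _ h, fun r γ ψ h => hp.arch r _ _ h⟩,
    ⟨fun r ψ => hi.pos r _, fun r ψ => hi.neg r _⟩⟩
  have := hl.subst (fun n => BeliefFormula.toKB (σ n)) _ h
  simpa only [Set.mem_ofPred_eq, BeliefFormula.toKB, mapOp_subst] using this

/-! ### Lindenbaum construction with Archimedean witnesses -/

/-- A maximal consistent set of belief formulas that respects the Archimedean rule. -/
structure IsArchimedeanTheory (Γ : Set BeliefFormula) : Prop where
  valuation : IsValuation (· ∈ Γ)
  sigmaH_subset : SigmaH ⊆ Γ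
  arch : ∀ (r : ProbIndex) (φ : BeliefFormula), (∀ s : ProbIndex, s < r → op s φ ∈ Γ) → op r φ ∈ Γ

theorem IsLogic.mem_of_forall_valuation {O : Type} {S : Set (Formula O)} (hS : IsLogic S)
    {φ ψ : Formula O} (hφ : φ ∈ S) (h : ∀ v, IsValuation v → v φ → v ψ) : ψ ∈ S :=
  hS.mp φ ψ (hS.taut _ (isTautology_iff.2 fun v hv => (hv.imp _ _).2 (h v hv))) hφ

theorem IsLogic.mem_of_forall_valuation₂ {O : Type} {S : Set (Formula O)} (hS : IsLogic S)
    {φ ψ χ : Formula O} (hφ : φ ∈ S) (hψ : ψ ∈ S)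
    (h : ∀ v, IsValuation v → v φ → v ψ → v χ) : χ ∈ S :=
  hS.mp ψ χ (hS.mem_of_forall_valuation hφ fun v hv h₁ => (hv.imp _ _).2 (h v hv h₁)) hψ

/-- One step of the construction of an Archimedean theory: a consistent formula can be
strengthened so that it decides a given formula, with a witness if that formula is refuted. -/
theorem exists_consistent_refinement (γ ψ : BeliefFormula) (hγ : neg γ ∉ SigmaH) :
    ∃ γ' : BeliefFormula, neg γ' ∉ SigmaH ∧ γ'.imp γ ∈ SigmaH ∧
      (γ'.imp ψ ∈ SigmaH ∨ γ'.imp (neg ψ) ∈ SigmaH ∧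
        ∀ (r : ProbIndex) (χ : BeliefFormula), ψ = op r χ →
          ∃ s : ProbIndex, s < r ∧ γ'.imp (neg (op s χ)) ∈ SigmaH) := by
  have hl := isLogic_sigmaH
  have left (α β : BeliefFormula) : (α.and β).imp α ∈ SigmaH :=
    hl.taut _ (isTautology_iff.2 fun v hv => by simp only [hv.imp, hv.and]; tauto)
  have right (α β : BeliefFormula) : (α.and β).imp β ∈ SigmaH :=
    hl.taut _ (isTautology_iff.2 fun v hv => by simp only [hv.imp, hv.and]; tauto)
  by_cases hcon : neg (γ.and (neg ψ)) ∈ SigmaH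
  · refine ⟨γ.and ψ, fun h => hγ ?_, left _ _, .inl (right _ _)⟩
    refine hl.mem_of_forall_valuation₂ hcon h fun v hv => ?_
    simp only [hv.neg, hv.and]; tauto
  · by_cases hop : ∃ (r : ProbIndex) (χ : BeliefFormula), ψ = op r χ
    · obtain ⟨r, χ, rfl⟩ := hop
      -- Without a witness, the Archimedean rule with antecedent `γ ∧ ¬L r χ` would make that
      -- antecedent inconsistent.
      obtain ⟨s, hs, hsc⟩ : ∃ s : ProbIndex, s < r ∧
          neg ((γ.and (neg (op r χ))).and (neg (op s χ))) ∉ SigmaH := by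
        by_contra! hall
        refine hcon (hl.mem_of_forall_valuation (φ := (γ.and (neg (op r χ))).imp (op r χ)) ?_ ?_)
        · exact satisfiesProbabilityAxioms_sigmaH.arch r _ χ fun s hs => hall s hs
        · intro v hv; simp only [hv.imp, hv.neg, hv.and]; tauto
      refine ⟨_, hsc, ?_, .inr ⟨?_, ?_⟩⟩
      · exact hl.taut _ (isTautology_iff.2 fun v hv => by simp only [hv.imp, hv.and]; tauto)
      · exact hl.taut _ (isTautology_iff.2 fun v hv => by simp only [hv.imp, hv.and]; tauto)
      · rintro r' χ' h
        cases h
        exact ⟨s, hs, right _ _⟩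
    · exact ⟨γ.and (neg ψ), hcon, left _ _, .inr ⟨right _ _, fun r χ h => (hop ⟨r, χ, h⟩).elim⟩⟩

/-- Start from `¬φ` and decide the countably many formulas in turn. The witnesses make the limit
Archimedean, although the rule has infinitely many premises. -/
theorem exists_isArchimedeanTheory {φ : BeliefFormula} (hφ : φ ∉ SigmaH) :
    ∃ Γ, IsArchimedeanTheory Γ ∧ φ ∉ Γ := by
  have hl := isLogic_sigmaH
  have : Countable BeliefFormula := Formula.countable
  have : Nonempty BeliefFormula := ⟨φ⟩
  obtain ⟨f, hf⟩ := exists_surjective_nat BeliefFormula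
  choose! next hcons hle hdec using exists_consistent_refinement
  let g : ℕ → BeliefFormula := fun n => Nat.rec (neg φ) (fun n γ => next γ (f n)) n
  have gc : ∀ n, neg (g n) ∉ SigmaH := by
    intro n
    induction n with
    | zero =>
      intro h
      refine hφ (hl.mem_of_forall_valuation h fun v hv => ?_)
      change v (neg (neg φ)) → v φ
      simp only [hv.neg]; tauto
    | succ n ih => exact hcons _ _ ih
  have trans {α β χ : BeliefFormula} (h₁ : α.imp β ∈ SigmaH) (h₂ : β.imp χ ∈ SigmaH) :
      α.imp χ ∈ SigmaH :=
    hl.mem_of_forall_valuation₂ h₁ h₂ fun v hv => by simp only [hv.imp]; tauto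
  have gle : ∀ m n, m ≤ n → (g n).imp (g m) ∈ SigmaH := by
    intro m n h
    induction n, h using Nat.le_induction with
    | base => exact hl.taut _ (isTautology_iff.2 fun v hv => by simp only [hv.imp]; tauto)
    | succ n _ ih => exact trans (hle _ (f n) (gc n)) ih
  let Γ : Set BeliefFormula := {ψ | ∃ n, (g n).imp ψ ∈ SigmaH}
  have cons {ψ : BeliefFormula} (h₁ : ψ ∈ Γ) (h₂ : neg ψ ∈ Γ) : False := by
    obtain ⟨m, hm⟩ := h₁
    obtain ⟨n, hn⟩ := h₂
    refine gc (max m n) (hl.mem_of_forall_valuation₂ (trans (gle _ _ (le_max_left m n)) hm)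
      (trans (gle _ _ (le_max_right m n)) hn) fun v hv => ?_)
    simp only [hv.imp, hv.neg]; tauto
  have neg_mem (ψ : BeliefFormula) : neg ψ ∈ Γ ↔ ψ ∉ Γ := by
    refine ⟨fun h₁ h₂ => cons h₂ h₁, fun h => ?_⟩
    obtain ⟨n, rfl⟩ := hf ψ
    rcases hdec (g n) (f n) (gc n) with h' | h'
    · exact (h ⟨n + 1, h'⟩).elim
    · exact ⟨n + 1, h'.1⟩
  refine ⟨Γ, ⟨⟨neg_mem, fun ψ χ => ⟨?_, ?_⟩⟩, fun ψ h => ?_, fun r χ h => ?_⟩, fun h => cons h ?_⟩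
  · rintro ⟨n, hn⟩
    constructor <;> refine ⟨n, hl.mem_of_forall_valuation hn fun v hv => ?_⟩ <;>
      (simp only [hv.imp, hv.and]; tauto)
  · rintro ⟨⟨m, hm⟩, ⟨n, hn⟩⟩
    refine ⟨max m n, hl.mem_of_forall_valuation₂ (trans (gle _ _ (le_max_left m n)) hm)
      (trans (gle _ _ (le_max_right m n)) hn) fun v hv => ?_⟩
    simp only [hv.imp, hv.and]; tauto
  · exact ⟨0, hl.mem_of_forall_valuation h fun v hv => by simp only [hv.imp]; tauto⟩
  · obtain ⟨n, hn⟩ := hf (op r χ)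
    rcases hdec (g n) (f n) (gc n) with h' | ⟨-, h'⟩
    · exact ⟨n + 1, hn ▸ h'⟩
    · obtain ⟨s, hs, hsχ⟩ := h' r χ hn
      exact (cons (h s hs) ⟨n + 1, hsχ⟩).elim
  · exact ⟨0, hl.taut _ (isTautology_iff.2 fun v hv => by simp only [hv.imp, g]; tauto)⟩

/-! ### Probability calculus inside an Archimedean theory -/

namespace IsArchimedeanTheory

variable {Γ : Set BeliefFormula}

theorem imp_mem (h : IsArchimedeanTheory Γ) {φ ψ : BeliefFormula} :
    φ.imp ψ ∈ Γ ↔ (φ ∈ Γ → ψ ∈ Γ) := h.valuation.imp φ ψ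

theorem neg_mem (h : IsArchimedeanTheory Γ) {φ : BeliefFormula} :
    neg φ ∈ Γ ↔ φ ∉ Γ := h.valuation.neg φ

theorem and_mem (h : IsArchimedeanTheory Γ) {φ ψ : BeliefFormula} :
    φ.and ψ ∈ Γ ↔ φ ∈ Γ ∧ ψ ∈ Γ := h.valuation.and φ ψ

theorem zero_mem (h : IsArchimedeanTheory Γ) (φ : BeliefFormula) :
    op (0 : ProbIndex) φ ∈ Γ := h.sigmaH_subset (satisfiesProbabilityAxioms_sigmaH.zero φ)

theorem add_mem (h : IsArchimedeanTheory Γ) {r t u : ProbIndex} {φ ψ : BeliefFormula}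
    (hu : (u : ℚ) = r + t) (h₁ : op r (φ.and ψ) ∈ Γ) (h₂ : op t (φ.and (neg ψ)) ∈ Γ) :
    op u φ ∈ Γ :=
  h.imp_mem.1 (h.sigmaH_subset (satisfiesProbabilityAxioms_sigmaH.add r t u φ ψ hu))
    (h.and_mem.2 ⟨h₁, h₂⟩)

theorem add_notMem (h : IsArchimedeanTheory Γ) {r t u : ProbIndex} {φ ψ : BeliefFormula}
    (hu : (u : ℚ) = r + t) (h₁ : op r (φ.and ψ) ∉ Γ) (h₂ : op t (φ.and (neg ψ)) ∉ Γ) :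
    op u φ ∉ Γ :=
  h.neg_mem.1 <| h.imp_mem.1
    (h.sigmaH_subset (satisfiesProbabilityAxioms_sigmaH.neg_add r t u φ ψ hu))
    (h.and_mem.2 ⟨h.neg_mem.2 h₁, h.neg_mem.2 h₂⟩)

theorem neg_notMem (h : IsArchimedeanTheory Γ) {r s : ProbIndex} {φ : BeliefFormula}
    (hrs : 1 < (r : ℚ) + s) (h₁ : op r φ ∈ Γ) : op s (neg φ) ∉ Γ :=
  h.neg_mem.1 <| h.imp_mem.1
    (h.sigmaH_subset (satisfiesProbabilityAxioms_sigmaH.compl r s φ hrs)) h₁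

theorem congr (h : IsArchimedeanTheory Γ) {φ ψ : BeliefFormula} (hφψ : φ.iff ψ ∈ SigmaH)
    (r : ProbIndex) : op r φ ∈ Γ ↔ op r ψ ∈ Γ :=
  (h.valuation.iff _ _).1 (h.sigmaH_subset (satisfiesProbabilityAxioms_sigmaH.dis r φ ψ hφψ))

/-- Here `φ` is equivalent to `ψ ∧ φ`; adding `L 0 (ψ ∧ ¬φ)` gives the bound for `ψ`. -/
theorem mono (h : IsArchimedeanTheory Γ) {φ ψ : BeliefFormula}
    (hφψ : ∀ v, IsValuation v → v φ → v ψ) {r : ProbIndex} (h₁ : op r φ ∈ Γ) : op r ψ ∈ Γ := by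
  refine h.add_mem (t := 0) (ψ := φ) (by simp) ((h.congr ?_ r).1 h₁) (h.zero_mem _)
  refine isLogic_sigmaH.taut _ (isTautology_iff.2 fun v hv => ?_)
  have := hφψ v hv
  simp only [hv.iff, hv.and]; tauto

theorem certain_of_isTautology (h : IsArchimedeanTheory Γ) {φ : BeliefFormula}
    (hφ : φ.IsTautology) (r : ProbIndex) : op r φ ∈ Γ :=
  h.mono (fun v hv _ => isTautology_iff.1 hφ v hv)
    (h.sigmaH_subset (satisfiesProbabilityAxioms_sigmaH.verum r))

/-- Intersecting with a certain event does not change the probability. -/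
theorem and_mem_of_certain (h : IsArchimedeanTheory Γ) {φ ψ : BeliefFormula} {r : ProbIndex}
    (hφ : op r φ ∈ Γ) (hψ : op (1 : ProbIndex) ψ ∈ Γ) : op r (φ.and ψ) ∈ Γ := by
  -- If `L s (φ ∧ ψ)` failed for some `s < r`, additivity would give `φ ∧ ¬ψ` probability at least
  -- `r - s > 0`, against certainty of `ψ`.
  refine h.arch r _ fun s hs => ?_
  by_contra hn
  have hs' : (s : ℚ) < r := hs
  let t : ProbIndex := ⟨r - s, by linarith, by linarith [r.2.2, s.2.1]⟩
  refine h.add_notMem (u := r) (t := t) (by simp [t]) hn (fun ht => ?_) hφ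
  refine h.neg_notMem (s := t) (by simp [t, hs']) hψ (h.mono (fun v hv => ?_) ht)
  simp only [hv.and]; tauto

theorem certain_mono₂ (h : IsArchimedeanTheory Γ) {φ ψ χ : BeliefFormula}
    (H : ∀ v, IsValuation v → v φ → v ψ → v χ) {r : ProbIndex}
    (hφ : op r φ ∈ Γ) (hψ : op (1 : ProbIndex) ψ ∈ Γ) : op r χ ∈ Γ :=
  h.mono (fun v hv hv' => H v hv ((hv.and _ _).1 hv').1 ((hv.and _ _).1 hv').2)
    (h.and_mem_of_certain hφ hψ)

end IsArchimedeanTheory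

/-! ### The model with constant belief and universal knowledge -/

open Classical in
/-- The operator-free formula to which a formula reduces when the belief of every state is the one
described by `Γ` and knowledge is truth in all states. -/
noncomputable def reduct (Γ : Set BeliefFormula) : KBFormula → BeliefFormula
  | letter n => letter n
  | neg φ => neg (reduct Γ φ)
  | .and φ ψ => .and (reduct Γ φ) (reduct Γ ψ)
  | op (.L r) φ => if op r (reduct Γ φ) ∈ Γ then top else neg top
  | op .K φ => if (reduct Γ φ).IsTautology then top else neg top

/-- The formulas valid in the model described by `Γ`. -/
def validities (Γ : Set BeliefFormula) : Set KBFormula :=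
  {φ | ∀ σ : ℕ → KBFormula, (reduct Γ (φ.subst σ)).IsTautology}

section Validities

variable {Γ : Set BeliefFormula}

theorem Formula.IsValuation.comp_reduct {v : BeliefFormula → Prop} (hv : IsValuation v)
    (Γ : Set BeliefFormula) : IsValuation fun φ => v (reduct Γ φ) :=
  ⟨fun _ => hv.neg _, fun _ _ => hv.and _ _⟩

theorem Formula.IsValuation.reduct_L {v : BeliefFormula → Prop} (hv : IsValuation v)
    (r : ProbIndex) (φ : KBFormula) :
    v (reduct Γ (op (.L r) φ)) ↔ op r (reduct Γ φ) ∈ Γ := by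
  have := hv.top
  by_cases h : op r (reduct Γ φ) ∈ Γ <;> simp [reduct, h, hv.neg, this]

theorem Formula.IsValuation.reduct_K {v : BeliefFormula → Prop} (hv : IsValuation v)
    (φ : KBFormula) : v (reduct Γ (op .K φ)) ↔ (reduct Γ φ).IsTautology := by
  have := hv.top
  by_cases h : (reduct Γ φ).IsTautology <;> simp [reduct, h, hv.neg, this]

theorem mem_validities_iff {φ : KBFormula} : φ ∈ validities Γ ↔
    ∀ (σ : ℕ → KBFormula) (v : BeliefFormula → Prop), IsValuation v →
      v (reduct Γ (φ.subst σ)) :=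
  forall_congr' fun _ => isTautology_iff

theorem imp_mem_validities_iff {φ ψ : KBFormula} : φ.imp ψ ∈ validities Γ ↔
    ∀ (σ : ℕ → KBFormula) (v : BeliefFormula → Prop), IsValuation v →
      v (reduct Γ (φ.subst σ)) → v (reduct Γ (ψ.subst σ)) := by
  rw [mem_validities_iff]
  exact forall₃_congr fun σ v hv => (hv.comp_reduct Γ).imp _ _

theorem iff_mem_validities_iff {φ ψ : KBFormula} : φ.iff ψ ∈ validities Γ ↔
    ∀ (σ : ℕ → KBFormula) (v : BeliefFormula → Prop), IsValuation v →
      (v (reduct Γ (φ.subst σ)) ↔ v (reduct Γ (ψ.subst σ))) := by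
  rw [mem_validities_iff]
  exact forall₃_congr fun σ v hv => (hv.comp_reduct Γ).iff _ _

theorem isLogic_validities (Γ : Set BeliefFormula) : IsLogic (validities Γ) where
  taut φ h := mem_validities_iff.2 fun σ _ hv =>
    isTautology_iff.1 (h.subst σ) _ (hv.comp_reduct Γ)
  mp φ ψ h₁ h₂ := mem_validities_iff.2 fun σ v hv =>
    imp_mem_validities_iff.1 h₁ σ v hv (mem_validities_iff.1 h₂ σ v hv)
  -- Validity quantifies over all substitutions because having a tautological reduct need not
  -- survive substitution: `Γ` may hold beliefs about particular letters.
  subst σ φ h := fun τ => by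
    rw [subst_subst]
    exact h _

theorem IsArchimedeanTheory.satisfiesProbabilityAxioms (h : IsArchimedeanTheory Γ) :
    SatisfiesProbabilityAxioms KBOp.L (validities Γ) where
  zero φ := mem_validities_iff.2 fun σ v hv => (hv.reduct_L _ _).2 (h.zero_mem _)
  verum r := mem_validities_iff.2 fun σ v hv => (hv.reduct_L _ _).2 <|
    -- Substitution alters the letter inside `top`, but the result is still a tautology.
    h.certain_of_isTautology (isTautology_iff.2 fun _ hw =>
      isTautology_iff.1 ((isTautology_iff.2 fun _ hv => hv.top :
        (Formula.top : KBFormula).IsTautology).subst σ) _ (hw.comp_reduct Γ)) r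
  add r t u φ ψ hu := imp_mem_validities_iff.2 fun σ v hv hφ => by
    have hφ' := (hv.and _ _).1 hφ
    exact (hv.reduct_L _ _).2 (h.add_mem hu ((hv.reduct_L _ _).1 hφ'.1)
      ((hv.reduct_L _ _).1 hφ'.2))
  neg_add r t u φ ψ hu := imp_mem_validities_iff.2 fun σ v hv hφ => by
    have hφ' := (hv.and _ _).1 hφ
    exact (hv.neg _).2 fun hc => h.add_notMem hu
      (fun h₁ => (hv.neg _).1 hφ'.1 ((hv.reduct_L _ _).2 h₁))
      (fun h₁ => (hv.neg _).1 hφ'.2 ((hv.reduct_L _ _).2 h₁)) ((hv.reduct_L _ _).1 hc)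
  compl r s φ hrs := imp_mem_validities_iff.2 fun σ v hv hφ =>
    (hv.neg _).2 fun hc => h.neg_notMem hrs ((hv.reduct_L _ _).1 hφ) ((hv.reduct_L _ _).1 hc)
  dis r φ ψ hφψ := iff_mem_validities_iff.2 fun σ v hv => by
    refine (hv.reduct_L _ _).trans (.trans (h.congr ?_ r) (hv.reduct_L _ _).symm)
    -- Equivalence at every state is a tautology between reducts, so it lies in Σ_H.
    exact isLogic_sigmaH.taut _ (isTautology_iff.2 fun w hw =>
      (hw.iff _ _).2 (iff_mem_validities_iff.1 hφψ σ w hw))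
  arch r γ φ H := imp_mem_validities_iff.2 fun σ v hv hγ => (hv.reduct_L _ _).2 <|
    h.arch r _ fun s hs => (hv.reduct_L _ _).1 (imp_mem_validities_iff.1 (H s hs) σ v hv hγ)

/-- The truth value of `L r φ` is the same at all states, so its reduct or the negation of it is a
tautology. -/
theorem IsArchimedeanTheory.satisfiesIntrospection (h : IsArchimedeanTheory Γ) :
    SatisfiesIntrospection KBOp.L (validities Γ) where
  pos _ _ := imp_mem_validities_iff.2 fun _ _ hv hφ => (hv.reduct_L _ _).2 <|
    h.certain_of_isTautology (isTautology_iff.2 fun _ hw =>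
      (hw.reduct_L _ _).2 ((hv.reduct_L _ _).1 hφ)) 1
  neg _ _ := imp_mem_validities_iff.2 fun _ _ hv hφ => (hv.reduct_L _ _).2 <|
    h.certain_of_isTautology (isTautology_iff.2 fun _ hw => (hw.neg _).2 fun hc =>
      (hv.neg _).1 hφ ((hv.reduct_L _ _).2 ((hw.reduct_L _ _).1 hc))) 1

theorem satisfiesS5_validities (Γ : Set BeliefFormula) :
    SatisfiesS5 KBOp.K (validities Γ) where
  normal φ ψ := imp_mem_validities_iff.2 fun σ v hv hφψ => by
    refine ((hv.comp_reduct Γ).imp _ _).2 fun hφ => (hv.reduct_K _).2 ?_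
    exact isTautology_iff.2 fun w hw => ((hw.comp_reduct Γ).imp _ _).1
      (isTautology_iff.1 ((hv.reduct_K _).1 hφψ) w hw)
      (isTautology_iff.1 ((hv.reduct_K _).1 hφ) w hw)
  gen φ hφ := mem_validities_iff.2 fun σ v hv => (hv.reduct_K _).2 (hφ σ)
  refl φ := imp_mem_validities_iff.2 fun σ v hv hφ =>
    isTautology_iff.1 ((hv.reduct_K _).1 hφ) v hv
  pos φ := imp_mem_validities_iff.2 fun σ v hv hφ => (hv.reduct_K _).2 <|
    isTautology_iff.2 fun _ hw => (hw.reduct_K _).2 ((hv.reduct_K _).1 hφ)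
  neg φ := imp_mem_validities_iff.2 fun σ v hv hφ => (hv.reduct_K _).2 <|
    isTautology_iff.2 fun _ hw => (hw.neg _).2 fun hc =>
      (hv.neg _).1 hφ ((hv.reduct_K _).2 ((hw.reduct_K _).1 hc))

theorem IsArchimedeanTheory.satisfiesKnowledgeBelief (h : IsArchimedeanTheory Γ) :
    SatisfiesKnowledgeBelief KBOp.L KBOp.K (validities Γ) where
  know_pos _ _ := imp_mem_validities_iff.2 fun _ _ hv hφ => (hv.reduct_K _).2 <|
    isTautology_iff.2 fun _ hw => (hw.reduct_L _ _).2 ((hv.reduct_L _ _).1 hφ)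
  know_neg _ _ := imp_mem_validities_iff.2 fun _ _ hv hφ => (hv.reduct_K _).2 <|
    isTautology_iff.2 fun _ hw => (hw.neg _).2 fun hc =>
      (hv.neg _).1 hφ ((hv.reduct_L _ _).2 ((hw.reduct_L _ _).1 hc))
  know_certain _ := imp_mem_validities_iff.2 fun _ _ hv hφ => (hv.reduct_L _ _).2 <|
    h.certain_of_isTautology ((hv.reduct_K _).1 hφ) 1

theorem IsArchimedeanTheory.sigmaHK_subset_validities (h : IsArchimedeanTheory Γ) :
    SigmaHK ⊆ validities Γ :=
  Set.sInter_subset_of_mem ⟨isLogic_validities Γ, h.satisfiesProbabilityAxioms,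
    h.satisfiesIntrospection, satisfiesS5_validities Γ, h.satisfiesKnowledgeBelief⟩

/-! ### Reducts of `K`-free formulas and the conclusion -/

/-- Every `K`-free formula is equivalent, with certainty, to its reduct. -/
theorem IsArchimedeanTheory.reduct_toKB (h : IsArchimedeanTheory Γ) (φ : BeliefFormula) :
    (reduct Γ φ.toKB ∈ Γ ↔ φ ∈ Γ) ∧
      op (1 : ProbIndex) ((reduct Γ φ.toKB).iff φ) ∈ Γ := by
  induction φ with
  | letter n =>
    exact ⟨Iff.rfl, h.certain_of_isTautology (isTautology_iff.2 fun v hv => (hv.iff _ _).2 .rfl) 1⟩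
  | neg φ ih =>
    refine ⟨(h.valuation.neg _).trans (.trans (not_congr ih.1) (h.valuation.neg _).symm),
      h.mono (fun v hv h' => ?_) ih.2⟩
    exact (hv.iff _ _).2
      ((hv.neg _).trans (.trans (not_congr ((hv.iff _ _).1 h')) (hv.neg _).symm))
  | and φ ψ ih₁ ih₂ =>
    refine ⟨(h.valuation.and _ _).trans (.trans (and_congr ih₁.1 ih₂.1)
      (h.valuation.and _ _).symm), h.certain_mono₂ (fun v hv h₁ h₂ => ?_) ih₁.2 ih₂.2⟩
    exact (hv.iff _ _).2 ((hv.and _ _).trans (.trans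
      (and_congr ((hv.iff _ _).1 h₁) ((hv.iff _ _).1 h₂)) (hv.and _ _).symm))
  | op r φ ih =>
    have key : op r (reduct Γ (BeliefFormula.toKB φ)) ∈ Γ ↔ op r φ ∈ Γ :=
      ⟨fun h' => h.certain_mono₂ (fun v hv h₁ h₂ => ((hv.iff _ _).1 h₂).1 h₁) h' ih.2,
        fun h' => h.certain_mono₂ (fun v hv h₁ h₂ => ((hv.iff _ _).1 h₂).2 h₁) h' ih.2⟩
    refine ⟨(h.valuation.reduct_L _ _).trans key, ?_⟩
    -- The reduct is now a constant; introspection makes `Γ` certain that `L r φ` has the same truth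
    -- value.
    by_cases hr : op r φ ∈ Γ
    · refine h.mono (fun v hv h' => (hv.iff _ _).2 ?_)
        (h.imp_mem.1 (h.sigmaH_subset (satisfiesIntrospection_sigmaH.pos r φ)) hr)
      exact iff_of_true ((hv.reduct_L _ _).2 (key.2 hr)) h'
    · refine h.mono (fun v hv h' => (hv.iff _ _).2 ?_)
        (h.imp_mem.1 (h.sigmaH_subset (satisfiesIntrospection_sigmaH.neg r φ)) (h.neg_mem.2 hr))
      exact iff_of_false (fun hc => hr (key.1 ((hv.reduct_L _ _).1 hc))) ((hv.neg _).1 h')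

end Validities

theorem mem_sigmaH_of_toKB_mem {φ : BeliefFormula} (hφ : φ.toKB ∈ SigmaHK) : φ ∈ SigmaH := by
  by_contra hn
  obtain ⟨Γ, h, hφΓ⟩ := exists_isArchimedeanTheory hn
  have := h.sigmaHK_subset_validities hφ letter
  rw [subst_letter] at this
  exact hφΓ ((h.reduct_toKB φ).1.1 (isTautology_iff.1 this _ h.valuation))

theorem mainTheorem11 :
    (∀ (Ω : Type*) [Nonempty Ω] [MeasurableSpace Ω] (H : HarsanyiTypeSpace Ω),
      ∃ M : KnowledgeBeliefSpace Ω, M.toHarsanyiTypeSpace = H ∧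
        ∀ w : Ω, M.cell w = H.typeClass w) ∧
    (∀ φ : BeliefFormula, φ.toKB ∈ SigmaHK ↔ φ ∈ SigmaH) :=
  ⟨fun _ _ _ H => ⟨⟨H, Setoid.ker fun w => H.T w, H.certain, fun _ _ _ h => h⟩, rfl,
    fun _ => rfl⟩, fun _ => ⟨mem_sigmaH_of_toKB_mem, toKB_mem_sigmaHK⟩⟩
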